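/- For a nonnegative integer $\ell$ let $\rho_\ell\colon \mathrm{SO}(3)\to\mathbb{C}^{(2\ell+1)\times(2\ell+1)}$ be the irreducible representation of $\mathrm{SO}(3)$ given by the Wigner D-matrices: if $R=R_z(\alpha)R_y(\beta)R_z(\gamma)$, then $[\rho_\ell(R)]_{m',m}=e^{-im'\alpha}\,d^\ell_{m',m}(\beta)\,e^{-im\gamma}$ for $m',m\in\{-\ell,\dots,\ell\}$, where $d^\ell_{m',m}$ is Wigner's small d-function. For integers $\ell_1,\ell_2\ge 0$ and $|\ell_1-\ell_2|\le \ell\le \ell_1+\ell_2$ let $C_{\ell_1,\ell_2,\ell}$ be the $(2\ell_1+1)(2\ell_2+1)\times(2\ell+1)$ Clebsch–Gordan matrix, whose entry in row $(m_1,m_2)$ and column $m$ is the (real) Clebsch–Gordan coefficient $\langle \ell_1 m_1\,\ell_2 m_2\,|\,\ell m\rangle$ in the standard (Condon–Shortley) phase convention, as given by Racah's formula. Let $X$ be a set of inputs on which $\mathrm{SO}(3)$ acts, for instance the functions $x\colon S^2\to\mathbb{C}^d$ with $(R\cdot x)(u)=x(R^{-1}u)$. A vector $\hat f\in\mathbb{C}^{2\ell+1}$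 that depends on the input, i.e. a map $\hat f\colon X\to\mathbb{C}^{2\ell+1}$, is called $\rho_\ell$-covariant if $\hat f(R\cdot x)=\rho_\ell(R)\,\hat f(x)$ for all $R\in\mathrm{SO}(3)$ and $x\in X$. **Lemma.** Let $\hat f_{\ell_1}$ be a $\rho_{\ell_1}$-covariant vector and $\hat f_{\ell_2}$ a $\rho_{\ell_2}$-covariant vector (of the same input), and let $\ell$ be any integer with $|\ell_1-\ell_2|\le \ell\le \ell_1+\ell_2$. Then the Clebsch–Gordan projection $$\hat g_\ell = C_{\ell_1,\ell_2,\ell}^\top\,\bigl[\hat f_{\ell_1}\otimes \hat f_{\ell_2}\bigr]$$ is a $\rho_\ell$-covariant vector. -/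

import Mathlib

namespace ClebschGordan

/-- The rotation group `SO(3)`. -/
abbrev SO3 : Type := Matrix.specialOrthogonalGroup (Fin 3) ℝ

/-- Rotation by the angle `t` about the third coordinate axis. -/
noncomputable def rotZ (t : ℝ) : Matrix (Fin 3) (Fin 3) ℝ :=
  !![Real.cos t, -Real.sin t, 0; Real.sin t, Real.cos t, 0; 0, 0, 1]

/-- Rotation by the angle `t` about the second coordinate axis. -/
noncomputable def rotY (t : ℝ) : Matrix (Fin 3) (Fin 3) ℝ :=
  !![Real.cos t, 0, Real.sin t; 0, 1, 0; -Real.sin t, 0, Real.cos t]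

/-- A point of the unit circle is `(cos t, sin t)` for some `t`. -/
theorem exists_angle (x y : ℝ) (h : x ^ 2 + y ^ 2 = 1) :
    ∃ t : ℝ, Real.cos t = x ∧ Real.sin t = y := by
  have hn : ‖(⟨x, y⟩ : ℂ)‖ = 1 := by
    rw [Complex.norm_def, Complex.normSq_mk, Real.sqrt_eq_one]
    linarith
  have h0 : (⟨x, y⟩ : ℂ) ≠ 0 := by
    intro h0
    rw [h0] at hn
    simp at hn
  refine ⟨Complex.arg ⟨x, y⟩, ?_, ?_⟩
  · rw [Complex.cos_arg h0, hn]; simp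
  · rw [Complex.sin_arg, hn]; simp

/-- Every rotation has Euler angles in the `z`-`y`-`z` convention. -/
theorem exists_euler (R : SO3) :
    ∃ a : ℝ × ℝ × ℝ, (R : Matrix (Fin 3) (Fin 3) ℝ) = rotZ a.1 * rotY a.2.1 * rotZ a.2.2 := by
  obtain ⟨M, hM⟩ := R
  change ∃ a : ℝ × ℝ × ℝ, M = _
  rw [Matrix.mem_specialOrthogonalGroup_iff] at hM
  obtain ⟨hO, hdet⟩ := hM
  have hO' : M.transpose * M = 1 := (Matrix.mem_orthogonalGroup_iff' (Fin 3) ℝ).1 hO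
  -- `M e₃` in spherical coordinates
  have h22 : M 0 2 ^ 2 + M 1 2 ^ 2 + M 2 2 ^ 2 = 1 := by
    have h := congrFun (congrFun hO' 2) 2
    simp [Matrix.mul_apply, Fin.sum_univ_three] at h
    linarith
  have hr : √(M 0 2 ^ 2 + M 1 2 ^ 2) ^ 2 = M 0 2 ^ 2 + M 1 2 ^ 2 :=
    Real.sq_sqrt (by positivity)
  obtain ⟨b, hbc, hbs⟩ := exists_angle (M 2 2) (√(M 0 2 ^ 2 + M 1 2 ^ 2)) (by linarith)
  obtain ⟨a, ha0, ha1⟩ : ∃ a : ℝ, Real.sin b * Real.cos a = M 0 2 ∧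
      Real.sin b * Real.sin a = M 1 2 := by
    by_cases h0 : Real.sin b = 0
    · have h : M 0 2 ^ 2 + M 1 2 ^ 2 = 0 := by rw [← hr, ← hbs, h0]; ring
      have h1 : M 0 2 = 0 := by nlinarith [sq_nonneg (M 0 2), sq_nonneg (M 1 2)]
      have h2 : M 1 2 = 0 := by nlinarith [sq_nonneg (M 0 2), sq_nonneg (M 1 2)]
      exact ⟨0, by simp [h0, h1], by simp [h2]⟩
    · obtain ⟨a, h1, h2⟩ := exists_angle (M 0 2 / Real.sin b) (M 1 2 / Real.sin b) (by
        rw [div_pow, div_pow, ← add_div, ← hr, ← hbs]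
        exact div_self (pow_ne_zero 2 h0))
      exact ⟨a, by rw [h1]; field_simp, by rw [h2]; field_simp⟩
  -- `N = R_y(-b) R_z(-a) M` fixes `e₃`
  have hZ : ∀ t, rotZ t * rotZ (-t) = 1 := fun t => by
    have := Real.sin_sq_add_cos_sq t
    ext i j
    fin_cases i <;> fin_cases j <;>
      simp [rotZ, Matrix.mul_apply, Fin.sum_univ_three] <;> nlinarith
  have hY : ∀ t, rotY t * rotY (-t) = 1 := fun t => by
    have := Real.sin_sq_add_cos_sq t
    ext i j
    fin_cases i <;> fin_cases j <;>
      simp [rotY, Matrix.mul_apply, Fin.sum_univ_three] <;> nlinarith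
  have hZt : ∀ t, (rotZ t).transpose = rotZ (-t) := fun t => by
    ext i j; fin_cases i <;> fin_cases j <;> simp [rotZ]
  have hYt : ∀ t, (rotY t).transpose = rotY (-t) := fun t => by
    ext i j; fin_cases i <;> fin_cases j <;> simp [rotY]
  have hZd : ∀ t, (rotZ t).det = 1 := fun t => by
    have := Real.sin_sq_add_cos_sq t
    simp [rotZ, Matrix.det_fin_three]; nlinarith
  have hYd : ∀ t, (rotY t).det = 1 := fun t => by
    have := Real.sin_sq_add_cos_sq t
    simp [rotY, Matrix.det_fin_three]; nlinarith
  obtain ⟨N, hN⟩ : ∃ N, N = rotY (-b) * (rotZ (-a) * M) := ⟨_, rfl⟩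
  have hMN : M = rotZ a * rotY b * N := by
    calc M = rotZ a * rotZ (-a) * M := by rw [hZ, one_mul]
      _ = rotZ a * (rotY b * rotY (-b)) * rotZ (-a) * M := by rw [hY, mul_one]
      _ = rotZ a * rotY b * N := by rw [hN]; simp only [mul_assoc]
  have hNO : N.transpose * N = 1 := by
    rw [hN]
    simp only [Matrix.transpose_mul, hZt, hYt, neg_neg]
    calc M.transpose * rotZ a * rotY b * (rotY (-b) * (rotZ (-a) * M))
        = M.transpose * (rotZ a * (rotY b * rotY (-b)) * rotZ (-a)) * M := by
          simp only [mul_assoc]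
      _ = 1 := by rw [hY, mul_one, hZ, mul_one, hO']
  have hNd : N.det = 1 := by
    rw [hN, Matrix.det_mul, Matrix.det_mul, hZd, hYd, hdet]; norm_num
  have sa := Real.sin_sq_add_cos_sq a
  have sb := Real.sin_sq_add_cos_sq b
  have n02 : N 0 2 = 0 := by
    rw [hN]
    simp [rotY, rotZ, Matrix.mul_apply, Fin.sum_univ_three, Matrix.vecMul, dotProduct]
    rw [← ha0, ← ha1, ← hbc]
    linear_combination Real.cos b * Real.sin b * sa
  have n12 : N 1 2 = 0 := by
    rw [hN]
    simp [rotY, rotZ, Matrix.mul_apply, Fin.sum_univ_three, Matrix.vecMul, dotProduct]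
    rw [← ha0, ← ha1]
    ring
  have n22 : N 2 2 = 1 := by
    rw [hN]
    simp [rotY, rotZ, Matrix.mul_apply, Fin.sum_univ_three, Matrix.vecMul, dotProduct]
    rw [← ha0, ← ha1, ← hbc]
    linear_combination Real.sin b ^ 2 * sa + sb
  -- hence `N` is a rotation about the third axis
  have g02 := congrFun (congrFun hNO 0) 2
  have g12 := congrFun (congrFun hNO 1) 2
  have g00 := congrFun (congrFun hNO 0) 0
  have g11 := congrFun (congrFun hNO 1) 1
  have g01 := congrFun (congrFun hNO 0) 1
  simp [Matrix.mul_apply, Fin.sum_univ_three, n02, n12, n22] at g02 g12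
  simp [Matrix.mul_apply, Fin.sum_univ_three, g02, g12] at g00 g11 g01
  simp [Matrix.det_fin_three, n02, n12, n22] at hNd
  obtain ⟨c, hc, hs⟩ := exists_angle (N 0 0) (N 1 0) (by linarith)
  have n11 : N 1 1 = N 0 0 := by linear_combination N 0 0 * hNd - N 1 1 * g00 + N 1 0 * g01
  have n01 : N 0 1 = -N 1 0 := by linear_combination -N 1 0 * hNd - N 0 1 * g00 + N 0 0 * g01
  refine ⟨(a, b, c), ?_⟩
  have hNc : N = rotZ c := by
    ext i j
    fin_cases i <;> fin_cases j <;> simp [rotZ, n02, n12, n22, n11, n01, hc, hs, g02, g12]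
  rw [← hNc]
  exact hMN

/-- A triple `(α, β, γ)` of Euler angles of `R`, that is `R = R_z(α) R_y(β) R_z(γ)`. -/
noncomputable def eulerAngles (R : SO3) : ℝ × ℝ × ℝ := Classical.choose (exists_euler R)

/-- The factorial of an integer; it is used for nonnegative arguments only. -/
noncomputable def fact (n : ℤ) : ℝ := (Nat.factorial n.toNat : ℝ)

/-- `1 / n!`, with the usual convention that it vanishes for negative `n`. -/
noncomputable def invFact (n : ℤ) : ℝ := if n < 0 then 0 else 1 / fact n

/-- The magnetic quantum number `m ∈ {-ℓ, …, ℓ}` of the index `i ∈ {0, …, 2ℓ}`. -/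
def wt (ℓ : ℕ) (i : Fin (2 * ℓ + 1)) : ℤ := (i : ℤ) - ℓ

/-- Wigner's (small) d-matrix entry `d^ℓ_{m',m}(β)`. -/
noncomputable def smallD (ℓ : ℕ) (m' m : ℤ) (β : ℝ) : ℝ :=
  √(fact (ℓ + m') * fact (ℓ - m') * fact (ℓ + m) * fact (ℓ - m)) *
    ∑ s ∈ Finset.range (2 * ℓ + 1),
      (-1 : ℝ) ^ (m' - m + s) *
        (invFact (ℓ + m - s) * invFact s * invFact (m' - m + s) * invFact (ℓ - m' - s)) *
        Real.cos (β / 2) ^ (2 * ℓ + m - m' - 2 * s) * Real.sin (β / 2) ^ (m' - m + 2 * s)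

/-- The irreducible representation `ρ_ℓ` of `SO(3)`: the Wigner D-matrix
`D^ℓ_{m',m}(R) = e^{-i m' α} d^ℓ_{m',m}(β) e^{-i m γ}` for `R = R_z(α) R_y(β) R_z(γ)`.
The value does not depend on which Euler angles of `R` are taken. -/
noncomputable def rho (ℓ : ℕ) (R : SO3) :
    Matrix (Fin (2 * ℓ + 1)) (Fin (2 * ℓ + 1)) ℂ :=
  Matrix.of fun i j =>
    Complex.exp (-Complex.I * (wt ℓ i : ℂ) * ((eulerAngles R).1 : ℂ)) *
      (smallD ℓ (wt ℓ i) (wt ℓ j) (eulerAngles R).2.1 : ℂ) *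
      Complex.exp (-Complex.I * (wt ℓ j : ℂ) * ((eulerAngles R).2.2 : ℂ))

/-- The Clebsch–Gordan coefficient `⟨ℓ₁ m₁ ℓ₂ m₂ | ℓ m⟩` (Condon–Shortley phases), for
`|ℓ₁ - ℓ₂| ≤ ℓ ≤ ℓ₁ + ℓ₂` and `|m₁| ≤ ℓ₁`, `|m₂| ≤ ℓ₂`, `|m| ≤ ℓ`, by Racah's formula. -/
noncomputable def cgCoeff (ℓ₁ ℓ₂ ℓ : ℕ) (m₁ m₂ m : ℤ) : ℝ :=
  if m₁ + m₂ = m then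
    √((2 * ℓ + 1) * fact ((ℓ : ℤ) + ℓ₁ - ℓ₂) * fact ((ℓ : ℤ) - ℓ₁ + ℓ₂) *
        fact ((ℓ₁ : ℤ) + ℓ₂ - ℓ) /
        fact ((ℓ₁ : ℤ) + ℓ₂ + ℓ + 1)) *
      √(fact (ℓ + m) * fact (ℓ - m) * fact (ℓ₁ + m₁) * fact (ℓ₁ - m₁) *
        fact (ℓ₂ + m₂) * fact (ℓ₂ - m₂)) *
      ∑ k ∈ Finset.range (ℓ₁ + ℓ₂ + 1),
        (-1 : ℝ) ^ k *
          (invFact k * invFact ((ℓ₁ : ℤ) + ℓ₂ - ℓ - k) * invFact (ℓ₁ - m₁ - k) *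
            invFact (ℓ₂ + m₂ - k) * invFact ((ℓ : ℤ) - ℓ₂ + m₁ + k) *
            invFact ((ℓ : ℤ) - ℓ₁ - m₂ + k))
  else 0

/-- The Clebsch–Gordan matrix `C_{ℓ₁,ℓ₂,ℓ}`, of size `(2ℓ₁+1)(2ℓ₂+1) × (2ℓ+1)`. -/
noncomputable def cgMatrix (ℓ₁ ℓ₂ ℓ : ℕ) :
    Matrix (Fin (2 * ℓ₁ + 1) × Fin (2 * ℓ₂ + 1)) (Fin (2 * ℓ + 1)) ℂ :=
  Matrix.of fun p i => (cgCoeff ℓ₁ ℓ₂ ℓ (wt ℓ₁ p.1) (wt ℓ₂ p.2) (wt ℓ i) : ℂ)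

/-- The tensor (Kronecker) product of two vectors. -/
def tensorVec {ι κ : Type*} (v : ι → ℂ) (w : κ → ℂ) : ι × κ → ℂ := fun p => v p.1 * w p.2

/-- A vector `f` that depends on an input `x`, taken from a set `X` of inputs on which the
rotations act, is `ρ_ℓ`-covariant if rotating the input by `R` multiplies the vector by `ρ_ℓ(R)`.
For spherical images, `X` consists of functions `S² → ℂ^d`, with `(R • x) u = x (R⁻¹ u)`. -/
def IsCovariant {X : Type*} [MulAction SO3 X] (ℓ : ℕ) (f : X → Fin (2 * ℓ + 1) → ℂ) : Prop :=
  ∀ (R : SO3) (x : X), f (R • x) = (rho ℓ R).mulVec (f x)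

end ClebschGordan

namespace ClebschGordan

/-! The claim reduces to the intertwining relation `sum_cgMatrix_mul_rho`: the transposed
Clebsch–Gordan matrix carries `ρ_{ℓ₁} ⊗ ρ_{ℓ₂}` to `ρ_ℓ`. It is proved for arbitrary Euler angles,
so neither multiplicativity of `rho` nor independence of the chosen angles is needed.

The angles about the third axis give only phases, which match because the coefficients vanish unless
`m₁ + m₂ = m`. For the middle angle, binary forms are used: the small d-matrix is the action of the
half-angle rotation on normalised monomials (`basisForm_rotate`, `basisForm_rotate_inv`), and
Racah's sum is the expansion of a product of powers of `u₁v₂ - v₁u₂`, `u₁x + v₁y` and `u₂x + v₂y`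
(`sum_cgCoeff_generating`). A simultaneous rotation of the three pairs of variables preserves these
brackets, and comparing coefficients (`basisForm_left_injective`) gives `sum_cgCoeff_mul_smallD`. -/

/-! ### Inverse factorials and the binomial theorem for divided powers. -/

theorem invFact_natCast (n : ℕ) : invFact (n : ℤ) = 1 / (n.factorial : ℝ) := by
  simp [invFact, fact]

theorem invFact_of_neg {n : ℤ} (h : n < 0) : invFact n = 0 := if_pos h

theorem fact_pos (n : ℤ) : 0 < fact n := by
  unfold fact; exact_mod_cast Nat.factorial_pos _

/-- The divided power `x ^ t / t!`, which vanishes for negative `t`. -/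
noncomputable def dividedPow (x : ℝ) (t : ℤ) : ℝ := x ^ t.toNat * invFact t

theorem dividedPow_of_neg (x : ℝ) {t : ℤ} (h : t < 0) : dividedPow x t = 0 := by
  simp [dividedPow, invFact_of_neg h]

theorem sum_range_eq_sum_Icc (n : ℕ) (f : ℤ → ℝ) :
    ∑ s ∈ Finset.range (n + 1), f s = ∑ p ∈ Finset.Icc (0 : ℤ) n, f p := by
  refine Finset.sum_bij' (fun s _ => (s : ℤ)) (fun p _ => p.toNat) ?_ ?_ ?_ ?_ ?_ <;> simp
  omega

theorem sum_wt (ℓ : ℕ) (f : ℤ → ℝ) :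
    ∑ i : Fin (2 * ℓ + 1), f (wt ℓ i) = ∑ m ∈ Finset.Icc (-(ℓ : ℤ)) ℓ, f m := by
  refine (Fin.sum_univ_eq_sum_range (fun i : ℕ => f ((i : ℤ) - ℓ)) (2 * ℓ + 1)).trans ?_
  refine Finset.sum_bij' (fun s _ => (s : ℤ) - ℓ) (fun p _ => (p + ℓ).toNat) ?_ ?_ ?_ ?_ ?_ <;>
    simp <;> omega

/-- The binomial theorem for divided powers, as a sum over any large enough interval. -/
theorem sum_dividedPow_mul (x y : ℝ) {N A B r : ℤ} (hA : A ≤ r) (hB : r + N ≤ B) :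
    ∑ p ∈ Finset.Icc A B, dividedPow x (p - r) * dividedPow y (N + r - p) =
      dividedPow (x + y) N := by
  rcases lt_or_ge N 0 with hN | hN
  · rw [dividedPow_of_neg _ hN]
    refine Finset.sum_eq_zero fun p _ => ?_
    rcases lt_or_ge (p - r) 0 with h | h
    · rw [dividedPow_of_neg _ h, zero_mul]
    · rw [dividedPow_of_neg y (by omega), mul_zero]
  · lift N to ℕ using hN with n
    have hsub : Finset.Icc r (r + n) ⊆ Finset.Icc A B := Finset.Icc_subset_Icc hA hB
    rw [← Finset.sum_subset hsub]
    · have hbij : ∑ p ∈ Finset.Icc r (r + n), dividedPow x (p - r) * dividedPow y (n + r - p) =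
          ∑ s ∈ Finset.range (n + 1), dividedPow x s * dividedPow y ((n - s : ℕ) : ℤ) := by
        refine Finset.sum_bij' (fun p _ => (p - r).toNat) (fun s _ => (s : ℤ) + r) ?_ ?_ ?_ ?_ ?_
        · simp; omega
        · simp; omega
        · simp; omega
        · simp
        · intro p hp
          rw [Finset.mem_Icc] at hp
          congr 2 <;> omega
      rw [hbij]
      simp only [dividedPow, invFact_natCast, Int.toNat_natCast]
      rw [add_pow, Finset.sum_mul]
      refine Finset.sum_congr rfl fun s hs => ?_
      have hs' : s ≤ n := by simpa [Nat.lt_succ_iff] using hs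
      rw [Nat.cast_choose ℝ hs']
      have h1 : (n.factorial : ℝ) ≠ 0 := by exact_mod_cast n.factorial_ne_zero
      field_simp
    · intro p _ hp
      rw [Finset.mem_Icc, not_and_or] at hp
      rcases hp with h | h
      · rw [dividedPow_of_neg _ (by omega), zero_mul]
      · rw [dividedPow_of_neg y (by omega), mul_zero]

/-! ### Binary forms and the small d-matrix. -/

/-- The normalised monomial `u ^ (ℓ + m) v ^ (ℓ - m) / √((ℓ + m)! (ℓ - m)!)`. -/
noncomputable def basisForm (ℓ : ℕ) (m : ℤ) (u v : ℝ) : ℝ :=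
  √(fact (ℓ + m) * fact (ℓ - m)) * (dividedPow u (ℓ + m) * dividedPow v (ℓ - m))

theorem basisForm_eq {ℓ : ℕ} {m : ℤ} (h : m ∈ Finset.Icc (-(ℓ : ℤ)) ℓ) (u v : ℝ) :
    √(fact (ℓ + m) * fact (ℓ - m)) * basisForm ℓ m u v =
      u ^ (ℓ + m).toNat * v ^ (ℓ - m).toNat := by
  rw [Finset.mem_Icc] at h
  have h1 := fact_pos (ℓ + m)
  have h2 := fact_pos (ℓ - m)
  have h3 := Real.mul_self_sqrt (mul_pos h1 h2).le
  simp only [basisForm, dividedPow, invFact]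
  rw [if_neg (by omega), if_neg (by omega), ← mul_assoc, h3]
  field_simp

theorem wt_mem (ℓ : ℕ) (i : Fin (2 * ℓ + 1)) : wt ℓ i ∈ Finset.Icc (-(ℓ : ℤ)) ℓ := by
  have := i.2
  simp only [wt, Finset.mem_Icc]; omega

/-- A negative exponent makes an inverse factorial vanish on both sides, so truncation by `toNat`
and negative integer powers do no harm. The free weights `w₁, …, w₄` let one identity serve both
rows and columns. -/
theorem smallD_term (c s w₁ w₂ w₃ w₄ : ℝ) (p q r t : ℤ) :
    dividedPow (s * w₂) q * dividedPow (c * w₁) p *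
        (dividedPow (-s * w₃) r * dividedPow (c * w₄) t) =
      (-1 : ℝ) ^ r * (invFact p * invFact q * invFact r * invFact t) * c ^ (p + t) * s ^ (r + q) *
        (w₁ ^ p.toNat * w₂ ^ q.toNat * w₃ ^ r.toNat * w₄ ^ t.toNat) := by
  by_cases h : 0 ≤ p ∧ 0 ≤ q ∧ 0 ≤ r ∧ 0 ≤ t
  · obtain ⟨hp, hq, hr, ht⟩ := h
    lift p to ℕ using hp
    lift q to ℕ using hq
    lift r to ℕ using hr
    lift t to ℕ using ht
    have e1 : c ^ ((p : ℤ) + t) = c ^ p * c ^ t := by rw [← pow_add]; exact_mod_cast rfl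
    have e2 : s ^ ((r : ℤ) + q) = s ^ r * s ^ q := by rw [← pow_add]; exact_mod_cast rfl
    simp only [dividedPow, Int.toNat_natCast, zpow_natCast, mul_pow, neg_mul, e1, e2]
    rw [neg_pow]
    ring
  · have h' : p < 0 ∨ q < 0 ∨ r < 0 ∨ t < 0 := by omega
    rcases h' with h | h | h | h <;> simp [dividedPow_of_neg _ h, invFact_of_neg h]

theorem sqrt_fact_mul (ℓ : ℕ) (m' m : ℤ) :
    √(fact (ℓ + m') * fact (ℓ - m') * fact (ℓ + m) * fact (ℓ - m)) =
      √(fact (ℓ + m') * fact (ℓ - m')) * √(fact (ℓ + m) * fact (ℓ - m)) := by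
  rw [← Real.sqrt_mul (mul_pos (fact_pos _) (fact_pos _)).le]
  congr 1; ring

/-- The sum in the definition of `smallD`, multiplied by a monomial, in divided powers. -/
theorem smallD_sum_mul (ℓ : ℕ) (m' m : ℤ) (β z : ℝ) (w₁ w₂ w₃ w₄ : ℝ)
    (hz : ∀ s : ℤ, 0 ≤ ℓ + m - s → 0 ≤ s → 0 ≤ m' - m + s → 0 ≤ ℓ - m' - s →
      w₁ ^ (ℓ + m - s).toNat * w₂ ^ s.toNat * w₃ ^ (m' - m + s).toNat * w₄ ^ (ℓ - m' - s).toNat =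
        z) :
    (∑ s ∈ Finset.range (2 * ℓ + 1),
      (-1 : ℝ) ^ (m' - m + s) *
        (invFact (ℓ + m - s) * invFact s * invFact (m' - m + s) * invFact (ℓ - m' - s)) *
        Real.cos (β / 2) ^ (2 * ℓ + m - m' - 2 * s) * Real.sin (β / 2) ^ (m' - m + 2 * s)) * z =
    ∑ s ∈ Finset.range (2 * ℓ + 1),
      dividedPow (Real.sin (β / 2) * w₂) s * dividedPow (Real.cos (β / 2) * w₁) (ℓ + m - s) *
        (dividedPow (-Real.sin (β / 2) * w₃) (m' - m + s) *
          dividedPow (Real.cos (β / 2) * w₄) (ℓ - m' - s)) := by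
  rw [Finset.sum_mul]
  refine Finset.sum_congr rfl fun s _ => ?_
  rw [smallD_term]
  by_cases h : 0 ≤ (ℓ : ℤ) + m - s ∧ 0 ≤ m' - m + s ∧ 0 ≤ (ℓ : ℤ) - m' - s
  · rw [hz s h.1 (by omega) h.2.1 h.2.2]
    congr 2 <;> congr 1 <;> ring_nf
  · have h' : (ℓ : ℤ) + m - s < 0 ∨ m' - m + s < 0 ∨ (ℓ : ℤ) - m' - s < 0 := by omega
    rcases h' with h | h | h <;> simp [invFact_of_neg h]

theorem pow_toNat_mul {p q r : ℤ} (x : ℝ) (hp : 0 ≤ p) (hq : 0 ≤ q) (h : p + q = r) :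
    x ^ p.toNat * x ^ q.toNat = x ^ r.toNat := by
  rw [← pow_add]; congr 1; omega

/-- The columns of the small d-matrix describe the rotated binary forms. -/
theorem basisForm_rotate {ℓ : ℕ} {m : ℤ} (hm : m ∈ Finset.Icc (-(ℓ : ℤ)) ℓ) (β u v : ℝ) :
    basisForm ℓ m (Real.cos (β / 2) * u + Real.sin (β / 2) * v)
        (-Real.sin (β / 2) * u + Real.cos (β / 2) * v) =
      ∑ m' ∈ Finset.Icc (-(ℓ : ℤ)) ℓ, smallD ℓ m' m β * basisForm ℓ m' u v := by
  have hm2 := Finset.mem_Icc.1 hm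
  have h (m' : ℤ) (hm' : m' ∈ Finset.Icc (-(ℓ : ℤ)) ℓ) :
      smallD ℓ m' m β * basisForm ℓ m' u v = √(fact (ℓ + m) * fact (ℓ - m)) *
        ∑ s ∈ Finset.range (2 * ℓ + 1),
      dividedPow (Real.sin (β / 2) * v) s * dividedPow (Real.cos (β / 2) * u) (ℓ + m - s) *
        (dividedPow (-Real.sin (β / 2) * u) (m' - m + s) *
          dividedPow (Real.cos (β / 2) * v) (ℓ - m' - s)) := by
    rw [← smallD_sum_mul ℓ m' m β (u ^ (ℓ + m').toNat * v ^ (ℓ - m').toNat), ← basisForm_eq hm',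
      smallD, sqrt_fact_mul]
    · ring
    · intro s h1 h2 h3 h4
      rw [← pow_toNat_mul (r := ℓ + m') u h1 h3 (by ring),
        ← pow_toNat_mul (r := ℓ - m') v h2 h4 (by ring)]
      ring
  rw [Finset.sum_congr rfl h, ← Finset.mul_sum, Finset.sum_comm, basisForm]
  congr 1
  have h1 : dividedPow (Real.cos (β / 2) * u + Real.sin (β / 2) * v) (ℓ + m) =
      ∑ s ∈ Finset.range (2 * ℓ + 1), dividedPow (Real.sin (β / 2) * v) s *
        dividedPow (Real.cos (β / 2) * u) (ℓ + m - s) := by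
    rw [sum_range_eq_sum_Icc (2 * ℓ) (fun s => dividedPow (Real.sin (β / 2) * v) s *
        dividedPow (Real.cos (β / 2) * u) (ℓ + m - s)), add_comm (_ * u),
      ← sum_dividedPow_mul (A := 0) (B := ((2 * ℓ : ℕ) : ℤ)) (r := 0) _ _ le_rfl
        (by push_cast; omega)]
    simp
  rw [h1, Finset.sum_mul]
  refine Finset.sum_congr rfl fun s hs => ?_
  rw [← Finset.mul_sum]
  -- The sum over `m'` is the binomial expansion of the `(ℓ - m)`-th divided power, shifted by `m -
  -- s`. The bound on `s` keeps its support inside `[-ℓ, ℓ]`; beyond it the first factor vanishes.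
  by_cases hs2 : (s : ℤ) ≤ ℓ + m
  · congr 1
    rw [← sum_dividedPow_mul (A := -(ℓ : ℤ)) (B := ℓ) (r := m - s) _ _ (by omega) (by omega)]
    refine Finset.sum_congr rfl fun p _ => ?_
    congr 2 <;> ring
  · rw [dividedPow_of_neg _ (show (ℓ : ℤ) + m - s < 0 by omega)]; simp

/-- The rows of the small d-matrix describe the binary forms under the inverse rotation. -/
theorem basisForm_rotate_inv {ℓ : ℕ} {m' : ℤ} (hm' : m' ∈ Finset.Icc (-(ℓ : ℤ)) ℓ) (β u v : ℝ) :
    basisForm ℓ m' (Real.cos (β / 2) * u - Real.sin (β / 2) * v)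
        (Real.sin (β / 2) * u + Real.cos (β / 2) * v) =
      ∑ m ∈ Finset.Icc (-(ℓ : ℤ)) ℓ, smallD ℓ m' m β * basisForm ℓ m u v := by
  have hm2 := Finset.mem_Icc.1 hm'
  have h (m : ℤ) (hm : m ∈ Finset.Icc (-(ℓ : ℤ)) ℓ) :
      smallD ℓ m' m β * basisForm ℓ m u v = √(fact (ℓ + m') * fact (ℓ - m')) *
        ∑ s ∈ Finset.range (2 * ℓ + 1),
      dividedPow (Real.sin (β / 2) * u) s * dividedPow (Real.cos (β / 2) * u) (ℓ + m - s) *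
        (dividedPow (-Real.sin (β / 2) * v) (m' - m + s) *
          dividedPow (Real.cos (β / 2) * v) (ℓ - m' - s)) := by
    rw [← smallD_sum_mul ℓ m' m β (u ^ (ℓ + m).toNat * v ^ (ℓ - m).toNat), ← basisForm_eq hm,
      smallD, sqrt_fact_mul]
    · ring
    · intro s h1 h2 h3 h4
      rw [← pow_toNat_mul (r := ℓ + m) u h1 h2 (by ring),
        ← pow_toNat_mul (r := ℓ - m) v h3 h4 (by ring)]
      ring
  rw [Finset.sum_congr rfl h, ← Finset.mul_sum, Finset.sum_comm, basisForm]
  congr 1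
  have h1 : dividedPow (Real.sin (β / 2) * u + Real.cos (β / 2) * v) (ℓ - m') =
      ∑ s ∈ Finset.range (2 * ℓ + 1), dividedPow (Real.sin (β / 2) * u) s *
        dividedPow (Real.cos (β / 2) * v) (ℓ - m' - s) := by
    rw [sum_range_eq_sum_Icc (2 * ℓ) (fun s => dividedPow (Real.sin (β / 2) * u) s *
        dividedPow (Real.cos (β / 2) * v) (ℓ - m' - s)),
      ← sum_dividedPow_mul (A := 0) (B := ((2 * ℓ : ℕ) : ℤ)) (r := 0) _ _ le_rfl
        (by push_cast; omega)]
    simp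
  rw [h1, Finset.mul_sum]
  refine Finset.sum_congr rfl fun s hs => ?_
  -- Here the sum over `m` expands the `(ℓ + m')`-th divided power, shifted by `s - ℓ`; the bound on
  -- `s` again keeps its support inside `[-ℓ, ℓ]`.
  by_cases hs2 : (s : ℤ) ≤ ℓ - m'
  · rw [sub_eq_add_neg, ← neg_mul,
      ← sum_dividedPow_mul (A := -(ℓ : ℤ)) (B := ℓ) (r := s - ℓ) _ _ (by omega) (by omega),
      Finset.sum_mul]
    refine Finset.sum_congr rfl fun p _ => ?_
    rw [show p - (s - ℓ : ℤ) = ℓ + p - s by ring, show ℓ + m' + (s - ℓ : ℤ) - p = m' - p + s by ring]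
    ring
  · simp [dividedPow_of_neg _ (show (ℓ : ℤ) - m' - s < 0 by omega)]

/-- At `v = 1` the forms are nonzero multiples of the distinct powers `t ^ i`, and a real polynomial
is determined by its values. -/
theorem basisForm_left_injective {ℓ : ℕ} {f g : Fin (2 * ℓ + 1) → ℝ}
    (h : ∀ t : ℝ, ∑ i, f i * basisForm ℓ (wt ℓ i) t 1 = ∑ i, g i * basisForm ℓ (wt ℓ i) t 1) :
    f = g := by
  have key (i : Fin (2 * ℓ + 1)) : ∃ k : ℝ, k ≠ 0 ∧
      ∀ t : ℝ, basisForm ℓ (wt ℓ i) t 1 = k * t ^ (i : ℕ) := by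
    have hw := Finset.mem_Icc.1 (wt_mem ℓ i)
    have h1 := fact_pos (ℓ + wt ℓ i)
    have h2 := fact_pos (ℓ - wt ℓ i)
    have h3 := (Real.sqrt_pos.2 (mul_pos h1 h2)).ne'
    refine ⟨(√(fact (ℓ + wt ℓ i) * fact (ℓ - wt ℓ i)))⁻¹, inv_ne_zero h3, fun t => ?_⟩
    have h4 := basisForm_eq (wt_mem ℓ i) t 1
    rw [one_pow, mul_one, show (ℓ + wt ℓ i).toNat = i by simp [wt]] at h4
    rw [← h4, inv_mul_cancel_left₀ h3]
  choose k hk hk' using key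
  have hpoly : (∑ i, Polynomial.C (f i * k i) * Polynomial.X ^ (i : ℕ)) =
      ∑ i, Polynomial.C (g i * k i) * Polynomial.X ^ (i : ℕ) := by
    refine Polynomial.funext fun t => ?_
    simpa [Polynomial.eval_finsetSum, hk', mul_assoc] using h t
  funext i
  have hc := congrArg (fun p => Polynomial.coeff p i) hpoly
  simp only [Polynomial.finsetSum_coeff, Polynomial.coeff_C_mul, Polynomial.coeff_X_pow,
    Fin.val_inj] at hc
  simpa [hk i] using hc


/-! ### The generating function of the Clebsch–Gordan coefficients. -/

/-- The part of Racah's formula that does not depend on the magnetic quantum numbers. -/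
noncomputable def cgNorm (ℓ₁ ℓ₂ ℓ : ℕ) : ℝ :=
  √((2 * ℓ + 1) * fact ((ℓ : ℤ) + ℓ₁ - ℓ₂) * fact ((ℓ : ℤ) - ℓ₁ + ℓ₂) *
        fact ((ℓ₁ : ℤ) + ℓ₂ - ℓ) /
        fact ((ℓ₁ : ℤ) + ℓ₂ + ℓ + 1))

theorem racah_term (u₁ v₁ u₂ v₂ x y : ℝ) (k p q r s t : ℤ) :
    dividedPow (-(v₁ * u₂)) k * dividedPow (u₁ * v₂) p *
        ((dividedPow (u₁ * x) s * dividedPow (v₁ * y) q) *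
          (dividedPow (u₂ * x) r * dividedPow (v₂ * y) t)) =
      (-1 : ℝ) ^ k.toNat *
        (invFact k * invFact p * invFact q * invFact r * invFact s * invFact t) *
        ((u₁ ^ p.toNat * u₁ ^ s.toNat) * (v₁ ^ k.toNat * v₁ ^ q.toNat) *
          ((u₂ ^ k.toNat * u₂ ^ r.toNat) * (v₂ ^ p.toNat * v₂ ^ t.toNat)) *
          ((x ^ s.toNat * x ^ r.toNat) * (y ^ q.toNat * y ^ t.toNat))) := by
  simp only [dividedPow, mul_pow, neg_pow (v₁ * u₂)]
  ring

/-- The square roots in Racah's formula cancel the normalisations of the three forms, and its six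
inverse factorials turn the monomials into six divided powers. Only `m = m₁ + m₂` contributes; if
that is out of range, every term on the right has a negative exponent. -/
theorem sum_cgCoeff_mul_basisForm {ℓ₁ ℓ₂ ℓ : ℕ} {m₁ m₂ : ℤ}
    (h₁ : m₁ ∈ Finset.Icc (-(ℓ₁ : ℤ)) ℓ₁) (h₂ : m₂ ∈ Finset.Icc (-(ℓ₂ : ℤ)) ℓ₂)
    (u₁ v₁ u₂ v₂ x y : ℝ) :
    (∑ m ∈ Finset.Icc (-(ℓ : ℤ)) ℓ, cgCoeff ℓ₁ ℓ₂ ℓ m₁ m₂ m * basisForm ℓ m x y) *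
        basisForm ℓ₂ m₂ u₂ v₂ * basisForm ℓ₁ m₁ u₁ v₁ =
      cgNorm ℓ₁ ℓ₂ ℓ * ∑ k ∈ Finset.range (ℓ₁ + ℓ₂ + 1),
        dividedPow (-(v₁ * u₂)) k * dividedPow (u₁ * v₂) ((ℓ₁ : ℤ) + ℓ₂ - ℓ - k) *
          ((dividedPow (u₁ * x) ((ℓ : ℤ) - ℓ₂ + m₁ + k) * dividedPow (v₁ * y) (ℓ₁ - m₁ - k)) *
            (dividedPow (u₂ * x) (ℓ₂ + m₂ - k) *
              dividedPow (v₂ * y) ((ℓ : ℤ) - ℓ₁ - m₂ + k))) := by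
  by_cases hm : m₁ + m₂ ∈ Finset.Icc (-(ℓ : ℤ)) ℓ
  · rw [Finset.sum_eq_single_of_mem _ hm (fun m _ hne => by simp [cgCoeff, hne.symm])]
    have hs : √(fact (ℓ + (m₁ + m₂)) * fact (ℓ - (m₁ + m₂)) * fact (ℓ₁ + m₁) * fact (ℓ₁ - m₁) *
        fact (ℓ₂ + m₂) * fact (ℓ₂ - m₂)) =
        √(fact (ℓ + (m₁ + m₂)) * fact (ℓ - (m₁ + m₂))) * √(fact (ℓ₁ + m₁) * fact (ℓ₁ - m₁)) *
          √(fact (ℓ₂ + m₂) * fact (ℓ₂ - m₂)) := by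
      have p (n : ℤ) := (fact_pos n).le
      rw [← Real.sqrt_mul (mul_nonneg (p _) (p _)),
        ← Real.sqrt_mul (mul_nonneg (mul_nonneg (p _) (p _)) (mul_nonneg (p _) (p _)))]
      congr 1; ring
    have e := basisForm_eq hm x y
    have e₁ := basisForm_eq h₁ u₁ v₁
    have e₂ := basisForm_eq h₂ u₂ v₂
    rw [cgCoeff, if_pos rfl, hs, ← cgNorm]
    have rearrange (N a b c S E B A : ℝ) :
        N * (a * b * c) * S * E * B * A = N * (S * ((b * A) * (c * B) * (a * E))) := by ring
    rw [rearrange]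
    rw [e, e₁, e₂, Finset.sum_mul]
    congr 1
    refine Finset.sum_congr rfl fun k _ => ?_
    rw [racah_term]
    by_cases h : 0 ≤ (ℓ₁ : ℤ) + ℓ₂ - ℓ - k ∧ 0 ≤ (ℓ₁ : ℤ) - m₁ - k ∧ 0 ≤ (ℓ₂ : ℤ) + m₂ - k ∧
        0 ≤ (ℓ : ℤ) - ℓ₂ + m₁ + k ∧ 0 ≤ (ℓ : ℤ) - ℓ₁ - m₂ + k
    · obtain ⟨a1, a2, a3, a4, a5⟩ := h
      have a0 : (0 : ℤ) ≤ k := by omega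
      rw [pow_toNat_mul (r := ℓ₁ + m₁) u₁ a1 a4 (by ring),
        pow_toNat_mul (r := ℓ₁ - m₁) v₁ a0 a2 (by ring),
        pow_toNat_mul (r := ℓ₂ + m₂) u₂ a0 a3 (by ring),
        pow_toNat_mul (r := ℓ₂ - m₂) v₂ a1 a5 (by ring),
        pow_toNat_mul (r := ℓ + (m₁ + m₂)) x a4 a3 (by ring),
        pow_toNat_mul (r := ℓ - (m₁ + m₂)) y a2 a5 (by ring), Int.toNat_natCast]
    · have h' : (ℓ₁ : ℤ) + ℓ₂ - ℓ - k < 0 ∨ (ℓ₁ : ℤ) - m₁ - k < 0 ∨ (ℓ₂ : ℤ) + m₂ - k < 0 ∨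
          (ℓ : ℤ) - ℓ₂ + m₁ + k < 0 ∨ (ℓ : ℤ) - ℓ₁ - m₂ + k < 0 := by omega
      rcases h' with h | h | h | h | h <;> simp [invFact_of_neg h]
  · rw [Finset.sum_eq_zero, zero_mul, zero_mul, Finset.sum_eq_zero, mul_zero]
    · intro k _
      rw [Finset.mem_Icc] at hm
      have h' : (ℓ₁ : ℤ) - m₁ - k < 0 ∨ (ℓ₂ : ℤ) + m₂ - k < 0 ∨
              (ℓ : ℤ) - ℓ₂ + m₁ + k < 0 ∨ (ℓ : ℤ) - ℓ₁ - m₂ + k < 0 := by omega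
      rcases h' with h | h | h | h <;> simp [dividedPow_of_neg _ h]
    · intro m hm'
      rw [cgCoeff, if_neg (fun h => hm (by rwa [h])), zero_mul]

/-- The generating function of the Clebsch–Gordan coefficients. -/
theorem sum_cgCoeff_generating (ℓ₁ ℓ₂ ℓ : ℕ) (u₁ v₁ u₂ v₂ x y : ℝ) :
    ∑ m₁ ∈ Finset.Icc (-(ℓ₁ : ℤ)) ℓ₁, (∑ m₂ ∈ Finset.Icc (-(ℓ₂ : ℤ)) ℓ₂,
      (∑ m ∈ Finset.Icc (-(ℓ : ℤ)) ℓ, cgCoeff ℓ₁ ℓ₂ ℓ m₁ m₂ m * basisForm ℓ m x y) *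
        basisForm ℓ₂ m₂ u₂ v₂) * basisForm ℓ₁ m₁ u₁ v₁ =
      cgNorm ℓ₁ ℓ₂ ℓ * (dividedPow (u₁ * v₂ - v₁ * u₂) ((ℓ₁ : ℤ) + ℓ₂ - ℓ) *
        (dividedPow (u₁ * x + v₁ * y) ((ℓ : ℤ) + ℓ₁ - ℓ₂) *
          dividedPow (u₂ * x + v₂ * y) ((ℓ : ℤ) - ℓ₁ + ℓ₂))) := by
  have h0 : dividedPow (u₁ * v₂ - v₁ * u₂) ((ℓ₁ : ℤ) + ℓ₂ - ℓ) =
      ∑ k ∈ Finset.range (ℓ₁ + ℓ₂ + 1),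
        dividedPow (-(v₁ * u₂)) k * dividedPow (u₁ * v₂) ((ℓ₁ : ℤ) + ℓ₂ - ℓ - k) := by
    rw [sum_range_eq_sum_Icc (ℓ₁ + ℓ₂) (fun k =>
        dividedPow (-(v₁ * u₂)) k * dividedPow (u₁ * v₂) ((ℓ₁ : ℤ) + ℓ₂ - ℓ - k)),
      sub_eq_neg_add (u₁ * v₂), ← sum_dividedPow_mul (A := 0) (B := ((ℓ₁ + ℓ₂ : ℕ) : ℤ)) (r := 0)
        _ _ le_rfl (by push_cast; omega)]
    simp
  rw [Finset.sum_congr rfl fun m₁ h₁ => (Finset.sum_mul _ _ _).trans <|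
    Finset.sum_congr rfl fun m₂ h₂ => sum_cgCoeff_mul_basisForm h₁ h₂ u₁ v₁ u₂ v₂ x y]
  simp_rw [← Finset.mul_sum]
  congr 1
  rw [h0, Finset.sum_mul, Finset.sum_congr rfl fun m₁ _ => Finset.sum_comm, Finset.sum_comm]
  refine Finset.sum_congr rfl fun k _ => ?_
  simp_rw [← Finset.mul_sum]
  -- For fixed `k` the sums over `m₁` and `m₂` separate into two binomial expansions, whose supports
  -- fit the ranges exactly under this bound; otherwise the power of `u₁ * v₂` vanishes.
  by_cases hk : (k : ℤ) ≤ (ℓ₁ : ℤ) + ℓ₂ - ℓ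
  · congr 1
    rw [← Finset.sum_mul,
      ← sum_dividedPow_mul (A := -(ℓ₁ : ℤ)) (B := ℓ₁) (r := ℓ₂ - ℓ - k) (u₁ * x) _ (by omega)
        (by omega),
      ← sum_dividedPow_mul (A := -(ℓ₂ : ℤ)) (B := ℓ₂) (r := k - ℓ₂) (u₂ * x) _ (by omega)
        (by omega)]
    congr 1 <;> refine Finset.sum_congr rfl fun m _ => ?_ <;> congr 2 <;> ring
  · rw [dividedPow_of_neg (u₁ * v₂) (show (ℓ₁ : ℤ) + ℓ₂ - ℓ - k < 0 by omega)]
    simp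

/-! ### Intertwining and covariance. -/

/-- Moves two linear maps from the arguments of a bilinear form onto its coefficients; applied both
to basis forms and to the covariant vectors. -/
theorem sum_sum_mul_sum_mul_sum {R ι κ : Type*} [CommRing R] [Fintype ι] [Fintype κ]
    (C : ι → κ → R) (a : ι → ι → R) (b : κ → κ → R) (e : ι → R) (f : κ → R) :
    ∑ i, (∑ j, C i j * ∑ j', b j j' * f j') * ∑ i', a i i' * e i' =
      ∑ i', (∑ j', (∑ i, ∑ j, C i j * a i i' * b j j') * f j') * e i' := by
  have h (i : ι) : (∑ j, C i j * ∑ j', b j j' * f j') = ∑ j', (∑ j, C i j * b j j') * f j' := by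
    simp_rw [Finset.mul_sum, Finset.sum_mul]
    rw [Finset.sum_comm]
    simp_rw [mul_assoc]
  simp_rw [h, Finset.mul_sum]
  rw [Finset.sum_comm]
  refine Finset.sum_congr rfl fun i' _ => ?_
  simp_rw [Finset.sum_mul]
  rw [Finset.sum_comm]
  refine Finset.sum_congr rfl fun j' _ => Finset.sum_congr rfl fun i _ =>
    Finset.sum_congr rfl fun j _ => by ring

theorem sum_cgCoeff_mul_smallD {ℓ₁ ℓ₂ ℓ : ℕ} (β : ℝ)
    (i' : Fin (2 * ℓ₁ + 1)) (j' : Fin (2 * ℓ₂ + 1)) (l : Fin (2 * ℓ + 1)) :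
    ∑ i, ∑ j, cgCoeff ℓ₁ ℓ₂ ℓ (wt ℓ₁ i) (wt ℓ₂ j) (wt ℓ l) * smallD ℓ₁ (wt ℓ₁ i) (wt ℓ₁ i') β *
        smallD ℓ₂ (wt ℓ₂ j) (wt ℓ₂ j') β =
      ∑ n, smallD ℓ (wt ℓ l) (wt ℓ n) β * cgCoeff ℓ₁ ℓ₂ ℓ (wt ℓ₁ i') (wt ℓ₂ j') (wt ℓ n) := by
  have gen (u₁ v₁ u₂ v₂ x y : ℝ) := sum_cgCoeff_generating ℓ₁ ℓ₂ ℓ u₁ v₁ u₂ v₂ x y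
  simp_rw [← sum_wt] at gen
  have rot {ℓ : ℕ} (i : Fin (2 * ℓ + 1)) (u v : ℝ) := basisForm_rotate (wt_mem ℓ i) β u v
  have rotInv {ℓ : ℕ} (i : Fin (2 * ℓ + 1)) (u v : ℝ) := basisForm_rotate_inv (wt_mem ℓ i) β u v
  simp_rw [← sum_wt] at rot rotInv
  set c := Real.cos (β / 2)
  set s := Real.sin (β / 2)
  have hcs : s ^ 2 + c ^ 2 = 1 := Real.sin_sq_add_cos_sq _
  -- Rotating both pairs `(uᵢ, vᵢ)` preserves `u₁v₂ - v₁u₂`, and in the other two brackets the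
  -- rotation passes, transposed, to `(x, y)`.
  have inv (u₁ v₁ u₂ v₂ x y : ℝ) := (gen (c * u₁ - s * v₁) (s * u₁ + c * v₁) (c * u₂ - s * v₂)
    (s * u₂ + c * v₂) x y).trans <| Eq.trans (by
      congr 2
      · congr 1; linear_combination (u₁ * v₂ - v₁ * u₂) * hcs
      · congr 2 <;> ring) (gen u₁ v₁ u₂ v₂ (c * x + s * y) (-s * x + c * y)).symm
  simp_rw [rotInv, rot, sum_sum_mul_sum_mul_sum] at inv
  -- Coefficients are compared in one pair of variables at a time, with its second variable set to
  -- 1.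
  have inv₁ (u₂ v₂ x y : ℝ) := congrFun (basisForm_left_injective fun t => inv t 1 u₂ v₂ x y) i'
  have inv₂ (x y : ℝ) := congrFun (basisForm_left_injective fun t => inv₁ t 1 x y) j'
  refine congrFun (basisForm_left_injective (ℓ := ℓ)
    (f := fun l => ∑ i, ∑ j, cgCoeff ℓ₁ ℓ₂ ℓ (wt ℓ₁ i) (wt ℓ₂ j) (wt ℓ l) *
      smallD ℓ₁ (wt ℓ₁ i) (wt ℓ₁ i') β * smallD ℓ₂ (wt ℓ₂ j) (wt ℓ₂ j') β)
    (g := fun l => ∑ n, smallD ℓ (wt ℓ l) (wt ℓ n) β *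
      cgCoeff ℓ₁ ℓ₂ ℓ (wt ℓ₁ i') (wt ℓ₂ j') (wt ℓ n)) fun t => ?_) l
  refine Eq.trans ?_ ((inv₂ t 1).trans ?_)
  · simp_rw [Finset.sum_mul]
    rw [Finset.sum_comm]
    refine Finset.sum_congr rfl fun i _ => ?_
    rw [Finset.sum_comm]
    exact Finset.sum_congr rfl fun j _ => Finset.sum_congr rfl fun l _ => by ring
  · simp_rw [Finset.mul_sum, Finset.sum_mul]
    rw [Finset.sum_comm]
    exact Finset.sum_congr rfl fun j _ => Finset.sum_congr rfl fun l _ => by ring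

/-- The Clebsch–Gordan matrix intertwines `ρ_{ℓ₁} ⊗ ρ_{ℓ₂}` and `ρ_ℓ`. -/
theorem sum_cgMatrix_mul_rho {ℓ₁ ℓ₂ ℓ : ℕ} (R : SO3)
    (i' : Fin (2 * ℓ₁ + 1)) (j' : Fin (2 * ℓ₂ + 1)) (l : Fin (2 * ℓ + 1)) :
    ∑ i, ∑ j, cgMatrix ℓ₁ ℓ₂ ℓ (i, j) l * rho ℓ₁ R i i' * rho ℓ₂ R j j' =
      ∑ n, rho ℓ R l n * cgMatrix ℓ₁ ℓ₂ ℓ (i', j') n := by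
  rcases h : eulerAngles R with ⟨α, β, γ⟩
  have key := congrArg (fun r : ℝ => (r : ℂ)) (sum_cgCoeff_mul_smallD β i' j' l)
  push_cast at key
  have key' := congrArg (fun z => Complex.exp (-Complex.I * (wt ℓ l : ℂ) * α) * z *
    Complex.exp (-Complex.I * ((wt ℓ₁ i' + wt ℓ₂ j' : ℤ) : ℂ) * γ)) key
  simp only [Finset.mul_sum, Finset.sum_mul] at key'
  simp only [rho, cgMatrix, Matrix.of_apply, h]
  refine Eq.trans ?_ (key'.trans ?_)
  · refine Finset.sum_congr rfl fun i _ => Finset.sum_congr rfl fun j _ => ?_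
    -- Selection rule: where the coefficient is nonzero, the two phases in `α` multiply to that of
    -- `ρ_ℓ`.
    by_cases hm : wt ℓ₁ i + wt ℓ₂ j = wt ℓ l
    · rw [← hm]
      push_cast
      simp only [mul_add, add_mul, Complex.exp_add]
      ring
    · simp [cgCoeff, hm]
  · refine Finset.sum_congr rfl fun n _ => ?_
    by_cases hm : wt ℓ₁ i' + wt ℓ₂ j' = wt ℓ n
    · rw [← hm]
      ring
    · simp [cgCoeff, hm]

end ClebschGordan

theorem mainTheorem1 {X : Type*} [MulAction ClebschGordan.SO3 X] (ℓ₁ ℓ₂ ℓ : ℕ)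
    (hℓ : |(ℓ₁ : ℤ) - (ℓ₂ : ℤ)| ≤ (ℓ : ℤ)) (hℓ' : ℓ ≤ ℓ₁ + ℓ₂)
    (f₁ : X → Fin (2 * ℓ₁ + 1) → ℂ) (f₂ : X → Fin (2 * ℓ₂ + 1) → ℂ)
    (hf₁ : ClebschGordan.IsCovariant ℓ₁ f₁) (hf₂ : ClebschGordan.IsCovariant ℓ₂ f₂) :
    ClebschGordan.IsCovariant ℓ (fun x =>
      (ClebschGordan.cgMatrix ℓ₁ ℓ₂ ℓ).transpose.mulVec
        (ClebschGordan.tensorVec (f₁ x) (f₂ x))) := by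
  intro R x
  funext l
  simp only [hf₁ R x, hf₂ R x, Matrix.mulVec, dotProduct, Matrix.transpose_apply,
    ClebschGordan.tensorVec, Fintype.sum_prod_type]
  have h := ClebschGordan.sum_sum_mul_sum_mul_sum
    (fun i j => ClebschGordan.cgMatrix ℓ₁ ℓ₂ ℓ (i, j) l) (ClebschGordan.rho ℓ₁ R)
    (ClebschGordan.rho ℓ₂ R) (f₁ x) (f₂ x)
  simp_rw [ClebschGordan.sum_cgMatrix_mul_rho] at h
  refine Eq.trans ?_ (h.trans ?_)
  · refine Finset.sum_congr rfl fun i _ => ?_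
    rw [Finset.sum_mul]
    exact Finset.sum_congr rfl fun j _ => by ring
  · simp_rw [Finset.mul_sum, Finset.sum_mul]
    refine Eq.symm (Finset.sum_comm.trans (Finset.sum_congr rfl fun i _ =>
      Finset.sum_comm.trans ?_))
    exact Finset.sum_congr rfl fun j _ => Finset.sum_congr rfl fun n _ => by ring
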